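/- Let $G$ be a (Hausdorff) locally compact abelian group, written additively, with Haar measure $\lambda$. A weight on $G$ is a continuous function $\omega\colon G\to(0,\infty)$ with $\omega(s+t)\le\omega(s)\omega(t)$ for all $s,t\in G$ and $\omega(0)=1$. For a weight $\omega$, let $L^1_\omega(G)$ be the Beurling algebra of (classes of) measurable functions $f\colon G\to\mathbb C$ with $\|f\|=\int_G|f(t)|\,\omega(t)\,d\lambda(t)<\infty$, with the convolution product $(f*g)(s)=\int_G f(t)g(s-t)\,d\lambda(t)$. Put $\tilde\sigma(t)=\sigma(-t)$. Let $\omega$ and $\sigma$ be weights on $G$ with $\omega\ge1$, $\omega\ge\sigma$ and $\omega\tilde\sigma\ge1$. Let $\varphi_0(f)=\int_G f\,d\lambda$ be the augmentation character of $L^1_{\omega\tilde\sigma}(G)$, and suppose that the only continuous linear functional $d$ on $L^1_{\omega\tilde\sigma}(G)$ with $d(f*g)=d(f)\varphi_0(g)+\varphi_0(f)d(g)$ for all $f,g\in L^1_{\omega\tilde\sigma}(G)$ is $d=0$. Then, for every Banach $L^1_\sigma(G)$-module $X$ (that is, every complex Banach space with a continuous bilinear multiplicative action of $L^1_\sigma(G)$,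 regarded as a symmetric bimodule, $x\cdot f=f\cdot x$), every continuous derivation $D\colon L^1_\omega(G)\to X$ is zero, i.e. every continuous linear $D$ with $D(f*g)=f\cdot D(g)+g\cdot D(f)$ for all $f,g\in L^1_\omega(G)$ vanishes. Here $X$ is an $L^1_\omega(G)$-module through the inclusion $L^1_\omega(G)\subseteq L^1_\sigma(G)$. -/

import Mathlib

/-!
# Beurling algebras on locally compact abelian groups

`G` is a locally compact abelian group, written additively, and `μ` a Haar measure on it.
-/

open MeasureTheory Filter Topology

namespace Beurling

/-- A weight on `G`: a continuous function `ω : G → (0, ∞)` with `ω (s + t) ≤ ω s * ω t` and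
`ω 0 = 1`. -/
structure Weight (G : Type*) [AddCommGroup G] [TopologicalSpace G] where
  /-- The underlying function. -/
  toFun : G → ℝ
  continuous' : Continuous toFun
  pos' : ∀ t, 0 < toFun t
  submul' : ∀ s t, toFun (s + t) ≤ toFun s * toFun t
  map_zero' : toFun 0 = 1

instance {G : Type*} [AddCommGroup G] [TopologicalSpace G] :
    CoeFun (Weight G) (fun _ => G → ℝ) := ⟨Weight.toFun⟩

/-- The pointwise product of two weights. -/
def Weight.mul {G : Type*} [AddCommGroup G] [TopologicalSpace G] (ω σ : Weight G) : Weight G where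
  toFun t := ω t * σ t
  continuous' := ω.continuous'.mul σ.continuous'
  pos' t := mul_pos (ω.pos' t) (σ.pos' t)
  submul' s t := by
    calc ω (s + t) * σ (s + t) ≤ (ω s * ω t) * (σ s * σ t) :=
          mul_le_mul (ω.submul' s t) (σ.submul' s t) (σ.pos' _).le
            (mul_pos (ω.pos' s) (ω.pos' t)).le
      _ = (ω s * σ s) * (ω t * σ t) := by ring
  map_zero' := by rw [ω.map_zero', σ.map_zero', one_mul]

/-- The reflected weight `t ↦ ω (-t)`. -/
def Weight.tilde {G : Type*} [AddCommGroup G] [TopologicalSpace G] [IsTopologicalAddGroup G]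
    (ω : Weight G) : Weight G where
  toFun t := ω (-t)
  continuous' := ω.continuous'.comp continuous_neg
  pos' t := ω.pos' (-t)
  submul' s t := by rw [neg_add]; exact ω.submul' (-s) (-t)
  map_zero' := by rw [neg_zero]; exact ω.map_zero'

section Convolution

/-- Continuous functions with compact support are dense in `L¹(μ)`. -/
lemma exists_cc_approx {G : Type*} [TopologicalSpace G] [LocallyCompactSpace G] [T2Space G]
    [MeasurableSpace G] [BorelSpace G] {μ : Measure G} [μ.Regular] {f : G → ℂ}
    (hf : Integrable f μ) {ε : ℝ} (hε : 0 < ε) :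
    ∃ g : G → ℂ, HasCompactSupport g ∧ (∫ x, ‖f x - g x‖ ∂μ) ≤ ε ∧ Continuous g ∧
      Integrable g μ := by
  have key : ∃ g : G → ℂ, eLpNorm (f - g) 1 μ ≤ ENNReal.ofReal ε ∧
      (Continuous g ∧ HasCompactSupport g) := by
    refine (memLp_one_iff_integrable.2 hf).induction_dense ENNReal.one_ne_top
      (fun g => Continuous g ∧ HasCompactSupport g) ?_ ?_ ?_ (by simpa using hε)
    · intro c t ht htμ ε hε
      obtain ⟨δ, δ0, hδ⟩ := ENNReal.exists_nnreal_pos_mul_lt (a := 2 * ‖c‖ₑ) (by finiteness) hε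
      have hδ0 : (δ : ENNReal) ≠ 0 := by simpa using δ0.ne'
      obtain ⟨s, hst, hs, -, hs'⟩ := ht.exists_isCompact_isClosed_sdiff_lt htμ.ne hδ0
      obtain ⟨u, htu, hu, -, hu'⟩ := ht.exists_isOpen_sdiff_lt htμ.ne hδ0
      obtain ⟨φ, h1, h0, hφ, hI⟩ := exists_continuous_one_zero_of_isCompact hs hu.isClosed_compl
        (Set.disjoint_compl_right_iff_subset.2 (hst.trans htu))
      refine ⟨fun x => (φ x : ℂ) * c, ?_, ?_, ?_⟩
      · rw [eLpNorm_one_eq_lintegral_enorm]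
        calc ∫⁻ x, ‖((fun x => (φ x : ℂ) * c) - t.indicator fun _ => c) x‖ₑ ∂μ
            ≤ ∫⁻ x, ((t \ s) ∪ (u \ t)).indicator (fun _ => ‖c‖ₑ) x ∂μ := by
              refine lintegral_mono fun x => ?_
              by_cases hxs : x ∈ s
              · simp [hst hxs, h1 hxs]
              by_cases hxt : x ∈ t
              · have e : ((φ x : ℂ) * c - c) = ((φ x - 1 : ℝ) : ℂ) * c := by push_cast; ring
                have : ‖((φ x - 1 : ℝ) : ℂ)‖ₑ ≤ 1 := by
                  rw [← ofReal_norm, Complex.norm_real, Real.norm_eq_abs]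
                  refine ENNReal.ofReal_le_one.2 (abs_le.2 ?_)
                  have := hI x
                  exact ⟨by linarith [this.1], by linarith [this.2]⟩
                simp only [Pi.sub_apply, Set.indicator_of_mem hxt, e, enorm_mul]
                rw [Set.indicator_of_mem (by simp [hxs, hxt])]
                exact mul_le_of_le_one_left' this
              by_cases hxu : x ∈ u
              · have : ‖((φ x : ℝ) : ℂ)‖ₑ ≤ 1 := by
                  rw [← ofReal_norm, Complex.norm_real, Real.norm_eq_abs]
                  refine ENNReal.ofReal_le_one.2 (abs_le.2 ?_)
                  have := hI x
                  exact ⟨by linarith [this.1], by linarith [this.2]⟩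
                simp only [Pi.sub_apply, Set.indicator_of_notMem hxt, sub_zero, enorm_mul]
                rw [Set.indicator_of_mem (by simp [hxu, hxt])]
                exact mul_le_of_le_one_left' this
              · have : φ x = 0 := h0 hxu
                simp [hxt, this]
          _ ≤ ‖c‖ₑ * μ ((t \ s) ∪ (u \ t)) := lintegral_indicator_const_le _ _
          _ ≤ ‖c‖ₑ * (δ + δ) := by
              gcongr
              exact (measure_union_le _ _).trans (add_le_add hs'.le hu'.le)
          _ = δ * (2 * ‖c‖ₑ) := by ring
          _ ≤ ε := hδ.le
      · exact (Complex.continuous_ofReal.comp φ.continuous).mul continuous_const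
      · exact (hφ.comp_left (g := fun r : ℝ => (r : ℂ)) (by simp)).mul_right
    · rintro f g ⟨h1, h2⟩ ⟨h3, h4⟩
      exact ⟨h1.add h3, h2.add h4⟩
    · rintro f ⟨h1, h2⟩
      exact (h1.integrable_of_hasCompactSupport h2).aestronglyMeasurable
  obtain ⟨g, hg, hgc, hgs⟩ := key
  have hgi : Integrable g μ := hgc.integrable_of_hasCompactSupport hgs
  refine ⟨g, hgs, ?_, hgc, hgi⟩
  rw [eLpNorm_one_eq_lintegral_enorm] at hg
  have := ofReal_integral_norm_eq_lintegral_enorm (hf.sub hgi)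
  simp only [Pi.sub_apply] at this hg
  rw [← this] at hg
  exact (ENNReal.ofReal_le_ofReal_iff hε.le).1 hg

/-- An integrable function is a dominated a.e. limit of continuous functions with compact support. -/
lemma exists_cc_seq {G : Type*} [TopologicalSpace G] [LocallyCompactSpace G] [T2Space G] [MeasurableSpace G] [BorelSpace G]
    {μ : Measure G} [μ.Regular] {f : G → ℂ} (hf : Integrable f μ) :
    ∃ (φ : ℕ → G → ℂ) (S : ℕ → G → ℝ) (C : ℝ),
      (∀ n, Continuous (φ n)) ∧ (∀ n, HasCompactSupport (φ n)) ∧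
      (∀ n, Continuous (S n)) ∧ (∀ n, HasCompactSupport (S n)) ∧ (∀ n t, 0 ≤ S n t) ∧
      (∀ t, Monotone fun n => S n t) ∧ (∀ n t, ‖φ n t‖ ≤ S n t) ∧
      (∀ᵐ t ∂μ, Tendsto (fun n => φ n t) atTop (𝓝 (f t))) ∧ ∀ n, ∫ t, S n t ∂μ ≤ C := by
  have h := fun n : ℕ => exists_cc_approx hf
    (ε := (1 / 2 : ℝ) ^ n) (by positivity)
  choose φ hc hle hcont hint using h
  have hd : ∀ n, Integrable (fun t => ‖f t - φ n t‖) μ := fun n => (hf.sub (hint n)).norm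
  have hd' : ∀ k, Integrable (fun t => ‖φ (k + 1) t - φ k t‖) μ :=
    fun k => ((hint (k + 1)).sub (hint k)).norm
  have hk : ∀ k, ∫ t, ‖φ (k + 1) t - φ k t‖ ∂μ ≤ 2 * (1 / 2 : ℝ) ^ k := by
    intro k
    calc ∫ t, ‖φ (k + 1) t - φ k t‖ ∂μ
        ≤ ∫ t, (‖f t - φ (k + 1) t‖ + ‖f t - φ k t‖) ∂μ := by
          refine integral_mono (hd' k) ((hd _).add (hd _)) fun t => ?_
          calc ‖φ (k + 1) t - φ k t‖ = ‖(f t - φ k t) - (f t - φ (k + 1) t)‖ := by congr 1; ring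
            _ ≤ _ := by rw [add_comm ‖f t - φ (k + 1) t‖]; exact norm_sub_le _ _
      _ = ∫ t, ‖f t - φ (k + 1) t‖ ∂μ + ∫ t, ‖f t - φ k t‖ ∂μ := integral_add (hd _) (hd _)
      _ ≤ (1 / 2 : ℝ) ^ (k + 1) + (1 / 2 : ℝ) ^ k := add_le_add (hle _) (hle _)
      _ ≤ _ := by rw [pow_succ]; nlinarith [pow_pos (show (0:ℝ) < 1 / 2 by norm_num) k]
  refine ⟨φ, fun n t => ‖φ 0 t‖ + ∑ k ∈ Finset.range n, ‖φ (k + 1) t - φ k t‖,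
    ∫ t, ‖φ 0 t‖ ∂μ + 4, hcont, hc, ?_, ?_, ?_, ?_, ?_, ?_, ?_⟩
  · intro n
    exact (hcont 0).norm.add (continuous_finsetSum _ fun k _ => ((hcont _).sub (hcont _)).norm)
  · intro n
    induction n with
    | zero => simpa using (hc 0).norm
    | succ n ih =>
      have := ih.add ((hc (n + 1)).sub (hc n)).norm
      refine (congrArg HasCompactSupport ?_).mp this
      funext t
      simp [Finset.sum_range_succ, add_assoc]
  · intro n t
    positivity
  · intro t
    refine monotone_nat_of_le_succ fun n => ?_
    simp only [Finset.sum_range_succ]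
    linarith [norm_nonneg (φ (n + 1) t - φ n t)]
  · intro n t
    have : φ n t = φ 0 t + ∑ k ∈ Finset.range n, (φ (k + 1) t - φ k t) := by
      rw [Finset.sum_range_sub (fun k => φ k t)]; ring
    rw [this]
    exact (norm_add_le _ _).trans (add_le_add le_rfl (norm_sum_le _ _))
  · have h1 : ∑' n, ∫⁻ t, ‖f t - φ n t‖ₑ ∂μ ≠ ⊤ := by
      have : ∀ n, ∫⁻ t, ‖f t - φ n t‖ₑ ∂μ ≤ ENNReal.ofReal ((1 / 2 : ℝ) ^ n) := by
        intro n
        refine (ofReal_integral_norm_eq_lintegral_enorm (hf.sub (hint n))).symm.trans_le ?_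
        exact ENNReal.ofReal_le_ofReal (hle n)
      refine ne_top_of_le_ne_top ?_ (ENNReal.tsum_le_tsum this)
      rw [← ENNReal.ofReal_tsum_of_nonneg (fun n => by positivity) summable_geometric_two]
      exact ENNReal.ofReal_ne_top
    have hm : ∀ n, AEMeasurable (fun t => ‖f t - φ n t‖ₑ) μ :=
      fun n => (hf.sub (hint n)).aestronglyMeasurable.enorm
    rw [← lintegral_tsum hm] at h1
    have h2 := ae_lt_top' (AEMeasurable.tsum hm) h1
    filter_upwards [h2] with t ht
    have h3 := ENNReal.tendsto_atTop_zero_of_tsum_ne_top ht.ne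
    rw [tendsto_iff_norm_sub_tendsto_zero]
    have h4 := (ENNReal.tendsto_toReal (ENNReal.zero_ne_top)).comp h3
    simpa [Function.comp_def, norm_sub_rev] using h4
  · intro n
    rw [integral_add (hint 0).norm (integrable_finsetSum _ fun k _ => hd' k),
      integral_finsetSum _ fun k _ => hd' k]
    gcongr
    calc _ ≤ ∑ k ∈ Finset.range n, 2 * (1 / 2 : ℝ) ^ k := Finset.sum_le_sum fun k _ => hk k
      _ = 2 * ∑ k ∈ Finset.range n, (1 / 2 : ℝ) ^ k := by rw [Finset.mul_sum]
      _ ≤ 2 * 2 := by gcongr; exact sum_geometric_two_le n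
      _ = 4 := by norm_num

/-- The convolution of continuous functions with compact support. -/
lemma conv_cc {G : Type*} [AddCommGroup G] [TopologicalSpace G] [IsTopologicalAddGroup G]
    [LocallyCompactSpace G] [T2Space G] [MeasurableSpace G] [BorelSpace G]
    {μ : Measure G} [μ.IsAddHaarMeasure] {𝕜 : Type*} [RCLike 𝕜] {a b : G → 𝕜} (ha : Continuous a) (hb : Continuous b)
    (ha' : HasCompactSupport a) (hb' : HasCompactSupport b) :
    Continuous (fun s => ∫ t, a t * b (s - t) ∂μ) ∧
     HasCompactSupport (fun s => ∫ t, a t * b (s - t) ∂μ) ∧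
    ∫ s, ∫ t, a t * b (s - t) ∂μ ∂μ = (∫ t, a t ∂μ) * ∫ t, b t ∂μ := by
  refine ⟨?_, ?_, ?_⟩
  · exact hb'.continuous_convolution_right (L := ContinuousLinearMap.mul ℝ 𝕜)
      ha.locallyIntegrable hb
  · exact HasCompactSupport.convolution (L := ContinuousLinearMap.mul ℝ 𝕜) (μ := μ) ha' hb'
  · rw [integral_integral_swap_of_hasCompactSupport]
    · simp_rw [integral_const_mul, integral_sub_right_eq_self, integral_mul_const]
    · fun_prop
    · have hK : IsCompact ((fun p : G × G => (p.1 + p.2, p.1)) '' (tsupport a ×ˢ tsupport b)) :=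
        (ha'.isCompact.prod hb'.isCompact).image (by fun_prop)
      refine HasCompactSupport.intro hK ?_
      rintro ⟨s, t⟩ h
      by_contra h0
      apply h
      simp only [Function.uncurry] at h0
      refine ⟨(t, s - t), ⟨subset_tsupport a ?_, subset_tsupport b ?_⟩, ?_⟩
      · exact left_ne_zero_of_mul h0
      · exact right_ne_zero_of_mul h0
      · simp

/-- If `ω f` and `ω g` are integrable then so is `ω (f * g)`. -/
lemma integrable_conv {G : Type*} [AddCommGroup G] [TopologicalSpace G] [IsTopologicalAddGroup G]
    [LocallyCompactSpace G] [T2Space G] [MeasurableSpace G] [BorelSpace G]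
    {μ : Measure G} [μ.IsAddHaarMeasure] [μ.Regular] {ω : G → ℝ} (hc : Continuous ω)
    (h0 : ∀ t, 0 < ω t) (hm : ∀ s t, ω (s + t) ≤ ω s * ω t) {f g : G → ℂ}
    (hf : Integrable (fun t => (ω t : ℂ) * f t) μ) (hg : Integrable (fun t => (ω t : ℂ) * g t) μ) :
    Integrable (fun s => (ω s : ℂ) * ∫ t, f t * g (s - t) ∂μ) μ := by
  obtain ⟨φ, S, A, hφ, hφ', hS, hS', hS0, hSm, hφS, hφl, hA⟩ := exists_cc_seq hf
  obtain ⟨ψ, R, B, hψ, hψ', hR, hR', hR0, hRm, hψR, hψl, hB⟩ := exists_cc_seq hg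
  have hne : ∀ t, (ω t : ℂ) ≠ 0 := fun t => by exact_mod_cast (h0 t).ne'
  have hωc : Continuous fun t => ((ω t : ℂ))⁻¹ := (Complex.continuous_ofReal.comp hc).inv₀ hne
  -- the approximating convolutions
  set T : ℕ → G → ℂ := fun n s =>
    (ω s : ℂ) * ∫ t, ((ω t : ℂ)⁻¹ * φ n t) * ((ω (s - t) : ℂ)⁻¹ * ψ n (s - t)) ∂μ with hT
  have hTc : ∀ n, Continuous (T n) := fun n =>
    (Complex.continuous_ofReal.comp hc).mul
      (conv_cc (hωc.mul (hφ n)) (hωc.mul (hψ n)) (hφ' n).mul_left (hψ' n).mul_left).1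
  -- the dominating function
  set k : ℕ → G → G → ENNReal := fun n s t => ENNReal.ofReal (S n t * R n (s - t)) with hk
  have hkmeas : ∀ n s, Measurable (k n s) := fun n s => by
    have h1 := hS n
    have h2 := (hR n).comp (continuous_sub_left s)
    exact (ENNReal.continuous_ofReal.comp (h1.mul h2)).measurable
  have hkmono : ∀ s t, Monotone fun n => k n s t := fun s t n m h =>
    ENNReal.ofReal_le_ofReal (mul_le_mul (hSm t h) (hRm _ h) (hR0 _ _) (hS0 _ _))
  have hkint : ∀ n s, Integrable (fun t => S n t * R n (s - t)) μ := fun n s => by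
    refine Continuous.integrable_of_hasCompactSupport ?_ (hS' n).mul_right
    have := hS n; have := hR n
    fun_prop
  have hki : ∀ n s, ∫⁻ t, k n s t ∂μ = ENNReal.ofReal (∫ t, S n t * R n (s - t) ∂μ) := fun n s =>
    (ofReal_integral_eq_lintegral_ofReal (hkint n s)
      (ae_of_all _ fun t => mul_nonneg (hS0 _ _) (hR0 _ _))).symm
  set H : G → ENNReal := fun s => ∫⁻ t, ⨆ n, k n s t ∂μ with hH
  have hHs : ∀ s, H s = ⨆ n, ∫⁻ t, k n s t ∂μ := fun s =>
    lintegral_iSup (fun n => hkmeas n s) fun n m h t => hkmono s t h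
  have hmm : ∀ n, Measurable fun s => ∫⁻ t, k n s t ∂μ := fun n => by
    simp_rw [hki]
    exact (ENNReal.continuous_ofReal.comp
      (conv_cc (hS n) (hR n) (hS' n) (hR' n)).1).measurable
  have hHint : ∫⁻ s, H s ∂μ ≤ ENNReal.ofReal (A * B) := by
    simp_rw [hHs]
    rw [lintegral_iSup hmm fun n m h s => lintegral_mono fun t => hkmono s t h]
    refine iSup_le fun n => ?_
    obtain ⟨h1, h2, h3⟩ := conv_cc (μ := μ) (hS n) (hR n) (hS' n) (hR' n)
    simp_rw [hki]
    rw [← ofReal_integral_eq_lintegral_ofReal (h1.integrable_of_hasCompactSupport h2)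
      (ae_of_all _ fun s => integral_nonneg fun t => mul_nonneg (hS0 _ _) (hR0 _ _)), h3]
    have hA0 : 0 ≤ ∫ t, S n t ∂μ := integral_nonneg fun t => hS0 n t
    exact ENNReal.ofReal_le_ofReal (mul_le_mul (hA n) (hB n)
      (integral_nonneg fun t => hR0 n t) (hA0.trans (hA n)))
  have hHm : Measurable H := by
    rw [show H = fun s => ⨆ n, ∫⁻ t, k n s t ∂μ from funext hHs]
    exact Measurable.iSup hmm
  have hHfin : ∀ᵐ s ∂μ, H s < ⊤ :=
    ae_lt_top hHm (ne_top_of_le_ne_top ENNReal.ofReal_ne_top hHint)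
  have hbd : ∀ n s t, ‖(ω s : ℂ) * (((ω t : ℂ)⁻¹ * φ n t) * ((ω (s - t) : ℂ)⁻¹ * ψ n (s - t)))‖
      ≤ S n t * R n (s - t) := by
    intro n s t
    have e : ‖(ω s : ℂ) * (((ω t : ℂ)⁻¹ * φ n t) * ((ω (s - t) : ℂ)⁻¹ * ψ n (s - t)))‖
        = (ω s / (ω t * ω (s - t))) * (‖φ n t‖ * ‖ψ n (s - t)‖) := by
      simp only [norm_mul, norm_inv, Complex.norm_real, Real.norm_eq_abs, abs_of_pos (h0 _)]
      field_simp
    rw [e]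
    have h1 : ω s / (ω t * ω (s - t)) ≤ 1 := by
      rw [div_le_one (mul_pos (h0 _) (h0 _))]
      simpa using hm t (s - t)
    calc _ ≤ 1 * (‖φ n t‖ * ‖ψ n (s - t)‖) := by gcongr
      _ ≤ _ := by
        rw [one_mul]
        exact mul_le_mul (hφS _ _) (hψR _ _) (norm_nonneg _) (hS0 _ _)
  have hlim : ∀ᵐ s ∂μ, Tendsto (fun n => T n s) atTop
      (𝓝 ((ω s : ℂ) * ∫ t, f t * g (s - t) ∂μ)) ∧ ∀ n, ‖T n s‖ₑ ≤ H s := by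
    filter_upwards [hHfin] with s hs
    have hfin : ∀ᵐ t ∂μ, (⨆ n, k n s t) < ⊤ :=
      ae_lt_top (Measurable.iSup fun n => hkmeas n s) hs.ne
    have hψl' : ∀ᵐ t ∂μ, Tendsto (fun n => ψ n (s - t)) atTop
        (𝓝 ((ω (s - t) : ℂ) * g (s - t))) :=
      (Measure.measurePreserving_sub_left μ s).quasiMeasurePreserving.ae hψl
    refine ⟨?_, fun n => ?_⟩
    · simp only [hT, ← integral_const_mul]
      refine tendsto_integral_of_dominated_convergence (fun t => (⨆ n, k n s t).toReal) ?_ ?_ ?_ ?_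
      · intro n
        refine Continuous.aestronglyMeasurable ?_
        have h1 := hωc.mul (hφ n)
        have h2 := (hωc.mul (hψ n)).comp (continuous_sub_left s)
        exact continuous_const.mul (h1.mul h2)
      · exact integrable_toReal_of_lintegral_ne_top
          (Measurable.iSup fun n => hkmeas n s).aemeasurable hs.ne
      · intro n
        filter_upwards [hfin] with t ht
        refine (hbd n s t).trans ?_
        rw [← ENNReal.ofReal_le_iff_le_toReal ht.ne]
        exact le_iSup (fun n => k n s t) n
      · filter_upwards [hφl, hψl'] with t h1 h2
        have h3 := ((h1.const_mul ((ω t : ℂ)⁻¹)).mul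
          (h2.const_mul ((ω (s - t) : ℂ)⁻¹))).const_mul (ω s : ℂ)
        simpa [inv_mul_cancel_left₀ (hne _)] using h3
    · simp only [hT, ← integral_const_mul]
      refine (enorm_integral_le_lintegral_enorm _).trans ?_
      refine lintegral_mono fun t => ?_
      refine le_trans ?_ (le_iSup (fun n => k n s t) n)
      rw [← ofReal_norm]
      exact ENNReal.ofReal_le_ofReal (hbd n s t)
  refine ⟨aestronglyMeasurable_of_tendsto_ae atTop (fun n => (hTc n).aestronglyMeasurable)
    (hlim.mono fun s h => h.1), ?_⟩
  refine lt_of_le_of_lt (lintegral_mono_ae ?_) (hHint.trans_lt ENNReal.ofReal_lt_top)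
  filter_upwards [hlim] with s hs
  exact le_of_tendsto (hs.1.enorm) (Eventually.of_forall hs.2)

end Convolution

/-- The measure `ω μ`, with density `ω` with respect to `μ`. -/
noncomputable def weightedMeasure {G : Type*} [AddCommGroup G] [TopologicalSpace G]
    [MeasurableSpace G] (μ : Measure G) (ω : Weight G) : Measure G :=
  μ.withDensity fun t => ENNReal.ofReal (ω t)

/-- The Banach space `L¹_ω(G)` of classes of functions `f : G → ℂ` with
`‖f‖ = ∫ |f t| ω t ∂μ < ∞`. -/
abbrev L1 {G : Type*} [AddCommGroup G] [TopologicalSpace G]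
    [MeasurableSpace G] (μ : Measure G) (ω : Weight G) : Type _ :=
  Lp ℂ 1 (weightedMeasure μ ω)

/-- `ω μ` and `μ` have the same null sets. -/
lemma ae_weightedMeasure {G : Type*} [AddCommGroup G] [TopologicalSpace G]
    [MeasurableSpace G] [BorelSpace G] (μ : Measure G) (ω : Weight G) :
    ae (weightedMeasure μ ω) = ae μ := by
  have hm : Measurable fun t => ENNReal.ofReal (ω t) :=
    (ENNReal.continuous_ofReal.comp ω.continuous').measurable
  refine le_antisymm (withDensity_absolutelyContinuous μ _).ae_le ?_
  exact (withDensity_absolutelyContinuous' hm.aemeasurable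
    (ae_of_all _ fun t => by simpa using ω.pos' t)).ae_le

/-- `f` lies in `L¹_ω(G)` if and only if `ω f` lies in `L¹(G)`. -/
lemma memLp_weightedMeasure_iff {G : Type*} [AddCommGroup G] [TopologicalSpace G]
    [MeasurableSpace G] [BorelSpace G] (μ : Measure G) (ω : Weight G) (f : G → ℂ) :
    MemLp f 1 (weightedMeasure μ ω) ↔ Integrable (fun t => (ω t : ℂ) * f t) μ := by
  have hm : Measurable fun t => ENNReal.ofReal (ω t) :=
    (ENNReal.continuous_ofReal.comp ω.continuous').measurable
  rw [memLp_one_iff_integrable, weightedMeasure,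
    integrable_withDensity_iff_integrable_smul' hm (by simp)]
  simp [ENNReal.toReal_ofReal (ω.pos' _).le]

/-- The convolution of two elements of `L¹_ω(G)` lies in `L¹_ω(G)`. -/
lemma memLp_conv {G : Type*} [AddCommGroup G] [TopologicalSpace G] [IsTopologicalAddGroup G]
    [LocallyCompactSpace G] [T2Space G] [MeasurableSpace G] [BorelSpace G]
    (μ : Measure G) [μ.IsAddHaarMeasure] [μ.Regular] (ω : Weight G) (f g : L1 μ ω) :
    MemLp (fun s => ∫ t, f t * g (s - t) ∂μ) 1 (weightedMeasure μ ω) :=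
  (memLp_weightedMeasure_iff μ ω _).2 <|
    integrable_conv ω.continuous' ω.pos' ω.submul'
      ((memLp_weightedMeasure_iff μ ω _).1 (Lp.memLp f))
      ((memLp_weightedMeasure_iff μ ω _).1 (Lp.memLp g))

/-- The product of the Beurling algebra `L¹_ω(G)`: the convolution
`(f * g) s = ∫ f t * g (s - t) ∂μ(t)`. -/
noncomputable def conv {G : Type*} [AddCommGroup G] [TopologicalSpace G] [IsTopologicalAddGroup G]
    [LocallyCompactSpace G] [T2Space G] [MeasurableSpace G] [BorelSpace G]
    {μ : Measure G} [μ.IsAddHaarMeasure] [μ.Regular] {ω : Weight G} (f g : L1 μ ω) : L1 μ ω :=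
  (memLp_conv μ ω f g).toLp _

lemma conv_ae {G : Type*} [AddCommGroup G] [TopologicalSpace G] [IsTopologicalAddGroup G]
    [LocallyCompactSpace G] [T2Space G] [MeasurableSpace G] [BorelSpace G]
    {μ : Measure G} [μ.IsAddHaarMeasure] [μ.Regular] {ω : Weight G} (f g : L1 μ ω) :
    conv f g =ᵐ[μ] fun s => ∫ t, f t * g (s - t) ∂μ := by
  have h := (memLp_conv μ ω f g).coeFn_toLp
  rwa [EventuallyEq, ae_weightedMeasure] at h

/-- The augmentation character `f ↦ ∫ f ∂μ` (used for weights `ω ≥ 1`, for which every element of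
`L¹_ω(G)` is integrable). -/
noncomputable def augmentation {G : Type*} [AddCommGroup G] [TopologicalSpace G]
    [MeasurableSpace G] {μ : Measure G} {ω : Weight G} (f : L1 μ ω) : ℂ :=
  ∫ t, f t ∂μ

/-- A continuous linear functional `d` on `L¹_ω(G)` is a point derivation at the augmentation
character `φ` if `d (f * g) = d f * φ g + φ f * d g`. -/
def IsAugmentationPointDerivation {G : Type*} [AddCommGroup G] [TopologicalSpace G]
    [IsTopologicalAddGroup G] [LocallyCompactSpace G] [T2Space G] [MeasurableSpace G] [BorelSpace G]
    {μ : Measure G} [μ.IsAddHaarMeasure] [μ.Regular] {ω : Weight G} (d : L1 μ ω →L[ℂ] ℂ) : Prop :=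
  ∀ f g : L1 μ ω, d (conv f g) = d f * augmentation g + augmentation f * d g

/-- A (symmetric) Banach `L¹_σ(G)`-module structure on the Banach space `X`: a continuous bilinear
action of the algebra `L¹_σ(G)`, the right action being equal to the left one. -/
structure BanachModule {G : Type*} [AddCommGroup G] [TopologicalSpace G] [IsTopologicalAddGroup G]
    [LocallyCompactSpace G] [T2Space G] [MeasurableSpace G] [BorelSpace G]
    (μ : Measure G) [μ.IsAddHaarMeasure] [μ.Regular] (σ : Weight G)
    (X : Type*) [NormedAddCommGroup X] [NormedSpace ℂ X] where
  /-- The action. -/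
  act : L1 μ σ →L[ℂ] X →L[ℂ] X
  act_conv : ∀ (f g : L1 μ σ) (x : X), act (conv f g) x = act f (act g x)

/-- The continuous inclusion `L¹_ω(G) → L¹_σ(G)` for `σ ≤ ω`. -/
noncomputable def incl {G : Type*} [AddCommGroup G] [TopologicalSpace G]
    [MeasurableSpace G] [BorelSpace G] (μ : Measure G) {ω σ : Weight G} (h : ∀ t, σ t ≤ ω t) :
    L1 μ ω →L[ℂ] L1 μ σ :=
  have hle : weightedMeasure μ σ ≤ weightedMeasure μ ω :=
    withDensity_mono (ae_of_all _ fun t => ENNReal.ofReal_le_ofReal (h t))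
  LinearMap.mkContinuous
    { toFun := fun f => ((Lp.memLp f).mono_measure hle).toLp f
      map_add' := fun f g => by
        rw [← MemLp.toLp_add]
        exact MemLp.toLp_congr _ _ ((Lp.coeFn_add f g).filter_mono (MeasureTheory.ae_mono hle))
      map_smul' := fun c f => by
        rw [RingHom.id_apply, ← MemLp.toLp_const_smul]
        exact MemLp.toLp_congr _ _ ((Lp.coeFn_smul c f).filter_mono (MeasureTheory.ae_mono hle)) }
    1 fun f => by
      rw [one_mul, LinearMap.coe_mk, AddHom.coe_mk, Lp.norm_toLp, Lp.norm_def]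
      exact ENNReal.toReal_mono (Lp.eLpNorm_ne_top f) (eLpNorm_mono_measure _ hle)

lemma incl_ae {G : Type*} [AddCommGroup G] [TopologicalSpace G]
    [MeasurableSpace G] [BorelSpace G] (μ : Measure G) {ω σ : Weight G} (h : ∀ t, σ t ≤ ω t)
    (f : L1 μ ω) : incl μ h f =ᵐ[μ] f := by
  have hle : weightedMeasure μ σ ≤ weightedMeasure μ ω :=
    withDensity_mono (ae_of_all _ fun t => ENNReal.ofReal_le_ofReal (h t))
  have h := ((Lp.memLp f).mono_measure hle).coeFn_toLp
  rwa [EventuallyEq, ae_weightedMeasure] at h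

lemma incl_conv {G : Type*} [AddCommGroup G] [TopologicalSpace G] [IsTopologicalAddGroup G]
    [LocallyCompactSpace G] [T2Space G] [MeasurableSpace G] [BorelSpace G]
    (μ : Measure G) [μ.IsAddHaarMeasure] [μ.Regular] {ω σ : Weight G} (h : ∀ t, σ t ≤ ω t)
    (f g : L1 μ ω) : incl μ h (conv f g) = conv (incl μ h f) (incl μ h g) := by
  apply Lp.ext
  rw [EventuallyEq, ae_weightedMeasure]
  filter_upwards [incl_ae μ h (conv f g), conv_ae f g, conv_ae (incl μ h f) (incl μ h g)]
    with s h1 h2 h3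
  rw [h1, h2, h3]
  refine integral_congr_ae ?_
  filter_upwards [incl_ae μ h f,
    (Measure.measurePreserving_sub_left μ s).quasiMeasurePreserving.ae (incl_ae μ h g)] with t h4 h5
  rw [h4, h5]

/-- For `σ ≤ ω`, a Banach `L¹_σ(G)`-module is a Banach `L¹_ω(G)`-module, as `L¹_ω(G)` is a
subalgebra of `L¹_σ(G)`. -/
noncomputable def BanachModule.restrict {G : Type*} [AddCommGroup G] [TopologicalSpace G]
    [IsTopologicalAddGroup G] [LocallyCompactSpace G] [T2Space G] [MeasurableSpace G] [BorelSpace G]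
    {μ : Measure G} [μ.IsAddHaarMeasure] [μ.Regular] {ω σ : Weight G}
    {X : Type*} [NormedAddCommGroup X] [NormedSpace ℂ X]
    (M : BanachModule μ σ X) (h : ∀ t, σ t ≤ ω t) : BanachModule μ ω X where
  act := M.act.comp (incl μ h)
  act_conv f g x := by
    simp only [ContinuousLinearMap.comp_apply, incl_conv, M.act_conv]

/-- A continuous linear map `D : L¹_ω(G) → X` into a Banach `L¹_ω(G)`-module is a derivation if
`D (f * g) = f · D g + D f · g`, where `x · g = g · x`. -/
def BanachModule.IsDerivation {G : Type*} [AddCommGroup G] [TopologicalSpace G]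
    [IsTopologicalAddGroup G] [LocallyCompactSpace G] [T2Space G] [MeasurableSpace G] [BorelSpace G]
    {μ : Measure G} [μ.IsAddHaarMeasure] [μ.Regular] {ω : Weight G}
    {X : Type*} [NormedAddCommGroup X] [NormedSpace ℂ X]
    (M : BanachModule μ ω X) (D : L1 μ ω →L[ℂ] X) : Prop :=
  ∀ f g : L1 μ ω, D (conv f g) = M.act f (D g) + M.act g (D f)

end Beurling

/-!
# Derivations of Beurling algebras into modules over a smaller weight

Write `δₜ` for translation by `t`. A derivation `D : L¹_ω(G) → X` ought to extend to the point
masses, and the product rule would then make `t ↦ δ₋ₜ · D δₜ` an additive function of `t`, of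
growth `ω t * σ (-t)` because `D` costs `ω t` and the module action costs `σ (-t)`. Integrating an
additive function `ψ` of that growth gives a point derivation `f ↦ ∫ f ψ` of `L¹_{ω σ̃}(G)` at the
augmentation character, so the hypothesis forces `δ₋ₜ · D δₜ = 0`: thus `D` commutes with
translations, hence with convolutions, `D (h * f) = h · D f`, and by the product rule it vanishes.

The point masses are not in the algebra and the module need not be essential, so this is carried
out with the defect `(δ₋ₜ * g) · D (δₜ * f) - g · D f`, which plays the role of
`(g * f) · (δ₋ₜ · D δₜ)`. Moving factors between `f`, `g` and the outside (`defect_conv_left`,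
`defect_conv_right`) shows that it is additive in `t` when `f` is a product (`defect_add`); products
of continuous functions with compact support are dense (`dense_conv_ofCc`), which is enough.

Two analytic facts enter. A convolution of continuous functions with compact support is a
vector-valued integral of translates (`conv_eq_integral`); this is how statements about translates
become statements about convolutions. And as `G` may be neither second countable nor σ-compact,
Fubini's theorem is only used for continuous functions with compact support; general elements are
reached by an approximation under which convolutions converge too (`exists_seq_tendsto_conv`).
-/

namespace Beurling

open scoped CompactlySupported Pointwise

set_option linter.unusedSectionVars false

variable {G : Type*} [AddCommGroup G] [TopologicalSpace G] [MeasurableSpace G] [BorelSpace G]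

/-! ### Norm, translations and integral functionals -/

section Basic

variable {μ : Measure G} {ω : Weight G}

lemma toLp_ae {f : G → ℂ} (hf : MemLp f 1 (weightedMeasure μ ω)) :
    (hf.toLp f : G → ℂ) =ᵐ[μ] f := by
  have h := hf.coeFn_toLp
  rwa [EventuallyEq, ae_weightedMeasure] at h

lemma L1_ext {f g : L1 μ ω} (h : f =ᵐ[μ] g) : f = g :=
  Lp.ext (by rwa [EventuallyEq, ae_weightedMeasure])

lemma toLp_congr {f g : G → ℂ} (hf : MemLp f 1 (weightedMeasure μ ω))
    (hg : MemLp g 1 (weightedMeasure μ ω)) (h : f =ᵐ[μ] g) : hf.toLp f = hg.toLp g :=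
  L1_ext ((toLp_ae hf).trans (h.trans (toLp_ae hg).symm))

lemma add_ae (f g : L1 μ ω) : (f + g : L1 μ ω) =ᵐ[μ] fun t => f t + g t := by
  have h := Lp.coeFn_add f g
  rwa [EventuallyEq, ae_weightedMeasure] at h

lemma sub_ae (f g : L1 μ ω) : (f - g : L1 μ ω) =ᵐ[μ] fun t => f t - g t := by
  have h := Lp.coeFn_sub f g
  rwa [EventuallyEq, ae_weightedMeasure] at h

lemma smul_ae (c : ℂ) (f : L1 μ ω) : (c • f : L1 μ ω) =ᵐ[μ] fun t => c * f t := by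
  have h := Lp.coeFn_smul c f
  rwa [EventuallyEq, ae_weightedMeasure] at h

lemma integrable_weight_mul (f : L1 μ ω) : Integrable (fun t => (ω t : ℂ) * f t) μ :=
  (memLp_weightedMeasure_iff μ ω _).1 (Lp.memLp f)

lemma L1_aestronglyMeasurable (f : L1 μ ω) : AEStronglyMeasurable (f : G → ℂ) μ := by
  refine (Lp.aestronglyMeasurable f).mono_ac (Measure.ae_le_iff_absolutelyContinuous.1 ?_)
  rw [ae_weightedMeasure]

lemma norm_eq (f : L1 μ ω) : ‖f‖ = ∫ t, ω t * ‖f t‖ ∂μ := by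
  have hm : Measurable fun t => ENNReal.ofReal (ω t) :=
    (ENNReal.continuous_ofReal.comp ω.continuous').measurable
  rw [L1.norm_eq_integral_norm]
  unfold weightedMeasure
  rw [integral_withDensity_eq_integral_toReal_smul hm (by simp)]
  simp [ENNReal.toReal_ofReal (ω.pos' _).le]

lemma norm_toLp {f : G → ℂ} (hf : MemLp f 1 (weightedMeasure μ ω)) :
    ‖hf.toLp f‖ = ∫ t, ω t * ‖f t‖ ∂μ := by
  rw [norm_eq]
  refine integral_congr_ae ?_
  filter_upwards [toLp_ae hf] with t ht
  rw [ht]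

lemma integrable_weight_mul_norm (f : L1 μ ω) : Integrable (fun t => ω t * ‖f t‖) μ := by
  refine (integrable_weight_mul f).norm.congr (ae_of_all _ fun t => ?_)
  simp [abs_of_pos (ω.pos' t)]

lemma integrable_mul_of_le (f : L1 μ ω) {ψ : G → ℂ} (hψ : Measurable ψ) {C : ℝ}
    (hC : ∀ t, ‖ψ t‖ ≤ C * ω t) : Integrable (fun t => f t * ψ t) μ := by
  refine ((integrable_weight_mul_norm f).const_mul C).mono'
    ((L1_aestronglyMeasurable f).mul hψ.aestronglyMeasurable) (ae_of_all _ fun t => ?_)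
  rw [norm_mul]
  nlinarith [mul_le_mul_of_nonneg_left (hC t) (norm_nonneg (f t))]

/-- A measurable function `ψ` with `|ψ| ≤ C ω` defines a continuous functional
`f ↦ ∫ f ψ` on `L¹_ω(G)`. -/
lemma exists_integral_functional {ψ : G → ℂ} (hψ : Measurable ψ) {C : ℝ}
    (hC : ∀ t, ‖ψ t‖ ≤ C * ω t) :
    ∃ d : L1 μ ω →L[ℂ] ℂ, ∀ f, d f = ∫ t, f t * ψ t ∂μ := by
  refine ⟨LinearMap.mkContinuous
    { toFun := fun f => ∫ t, f t * ψ t ∂μ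
      map_add' := fun f g => ?_
      map_smul' := fun c f => ?_ } C fun f => ?_, fun f => rfl⟩
  · rw [← integral_add (integrable_mul_of_le f hψ hC) (integrable_mul_of_le g hψ hC)]
    refine integral_congr_ae ?_
    filter_upwards [add_ae f g] with t ht
    rw [ht, add_mul]
  · rw [RingHom.id_apply, smul_eq_mul, ← integral_const_mul]
    refine integral_congr_ae ?_
    filter_upwards [smul_ae c f] with t ht
    rw [ht, mul_assoc]
  · rw [norm_eq, ← integral_const_mul]
    refine norm_integral_le_of_norm_le ((integrable_weight_mul_norm f).const_mul C)
      (ae_of_all _ fun t => ?_)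
    rw [norm_mul]
    nlinarith [mul_le_mul_of_nonneg_left (hC t) (norm_nonneg (f t))]

end Basic

section Translate

variable [IsTopologicalAddGroup G] [LocallyCompactSpace G] [T2Space G]
  {μ : Measure G} [μ.IsAddHaarMeasure] [μ.Regular] {ω : Weight G}

lemma comp_sub_right_ae {f g : G → ℂ} (h : f =ᵐ[μ] g) (t : G) :
    (fun s => f (s - t)) =ᵐ[μ] fun s => g (s - t) :=
  (measurePreserving_sub_right μ t).quasiMeasurePreserving.ae h

lemma comp_sub_left_ae {f g : G → ℂ} (h : f =ᵐ[μ] g) (s : G) :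
    (fun t => f (s - t)) =ᵐ[μ] fun t => g (s - t) :=
  (Measure.measurePreserving_sub_left μ s).quasiMeasurePreserving.ae h

lemma weight_le_translate (ω : Weight G) (s t : G) : ω s ≤ ω t * ω (s - t) := by
  simpa using ω.submul' t (s - t)

lemma memLp_translate (t : G) (f : L1 μ ω) :
    MemLp (fun s => f (s - t)) 1 (weightedMeasure μ ω) := by
  rw [memLp_weightedMeasure_iff]
  refine (((integrable_weight_mul_norm f).comp_sub_right t).const_mul (ω t)).mono' ?_
    (ae_of_all _ fun s => ?_)
  · exact (Complex.continuous_ofReal.comp ω.continuous').aestronglyMeasurable.mul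
      ((L1_aestronglyMeasurable f).comp_quasiMeasurePreserving
        (measurePreserving_sub_right μ t).quasiMeasurePreserving)
  · rw [norm_mul, Complex.norm_real, Real.norm_of_nonneg (ω.pos' s).le, ← mul_assoc]
    exact mul_le_mul_of_nonneg_right (weight_le_translate ω s t) (norm_nonneg _)

/-- Translation `f ↦ (s ↦ f (s - t))`, that is, convolution with the point mass at `t`, as a
bounded operator of `L¹_ω(G)`. -/
noncomputable def translate (μ : Measure G) [μ.IsAddHaarMeasure] [μ.Regular] (ω : Weight G)
    (t : G) : L1 μ ω →L[ℂ] L1 μ ω :=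
  LinearMap.mkContinuous
    { toFun := fun f => (memLp_translate t f).toLp _
      map_add' := fun f g => by
        rw [← MemLp.toLp_add]
        exact toLp_congr _ _ (comp_sub_right_ae (add_ae f g) t)
      map_smul' := fun c f => by
        rw [RingHom.id_apply, ← MemLp.toLp_const_smul]
        exact toLp_congr _ _ (comp_sub_right_ae (smul_ae c f) t) }
    (ω t) fun f => by
      rw [LinearMap.coe_mk, AddHom.coe_mk, norm_toLp, norm_eq,
        ← integral_sub_right_eq_self (fun s => ω s * ‖f s‖) t, ← integral_const_mul]
      refine integral_mono_of_nonneg (ae_of_all _ fun s => ?_)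
        (((integrable_weight_mul_norm f).comp_sub_right t).const_mul (ω t))
        (ae_of_all _ fun s => ?_)
      · exact mul_nonneg (ω.pos' s).le (norm_nonneg _)
      · dsimp only
        rw [← mul_assoc]
        exact mul_le_mul_of_nonneg_right (weight_le_translate ω s t) (norm_nonneg _)

lemma translate_ae (t : G) (f : L1 μ ω) : translate μ ω t f =ᵐ[μ] fun s => f (s - t) :=
  toLp_ae (memLp_translate t f)

lemma norm_translate_le (t : G) (f : L1 μ ω) : ‖translate μ ω t f‖ ≤ ω t * ‖f‖ :=
  ContinuousLinearMap.le_of_opNorm_le _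
    (LinearMap.mkContinuous_norm_le _ (ω.pos' t).le _) f

lemma translate_translate (s t : G) (f : L1 μ ω) :
    translate μ ω s (translate μ ω t f) = translate μ ω (s + t) f := by
  apply L1_ext
  refine (translate_ae _ _).trans (((comp_sub_right_ae (translate_ae t f) s)).trans ?_)
  refine EventuallyEq.trans (ae_of_all _ fun u => ?_) (translate_ae _ _).symm
  simp only [sub_sub]

lemma translate_zero (f : L1 μ ω) : translate μ ω 0 f = f :=
  L1_ext ((translate_ae _ _).trans (ae_of_all _ fun u => by simp only [sub_zero]))

lemma incl_translate {σ : Weight G} (h : ∀ t, σ t ≤ ω t) (t : G) (f : L1 μ ω) :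
    incl μ h (translate μ ω t f) = translate μ σ t (incl μ h f) :=
  L1_ext ((incl_ae μ h _).trans ((translate_ae t f).trans
    ((comp_sub_right_ae (incl_ae μ h f) t).symm.trans (translate_ae _ _).symm)))

lemma conv_comm (f g : L1 μ ω) : conv f g = conv g f := by
  apply L1_ext
  refine (conv_ae f g).trans (EventuallyEq.trans (ae_of_all _ fun s => ?_) (conv_ae g f).symm)
  dsimp only
  rw [← integral_sub_left_eq_self _ μ s]
  simp only [sub_sub_cancel, mul_comm]

lemma conv_translate (t : G) (f g : L1 μ ω) :
    conv f (translate μ ω t g) = translate μ ω t (conv f g) := by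
  apply L1_ext
  refine (conv_ae _ _).trans (EventuallyEq.trans (ae_of_all _ fun s => ?_)
    ((comp_sub_right_ae (conv_ae f g) t).symm.trans (translate_ae _ _).symm))
  refine integral_congr_ae ?_
  filter_upwards [comp_sub_left_ae (translate_ae t g) s] with u hu
  rw [hu, sub_right_comm]

lemma translate_conv (t : G) (f g : L1 μ ω) :
    conv (translate μ ω t f) g = translate μ ω t (conv f g) := by
  rw [conv_comm, conv_translate, conv_comm]

end Translate

/-! ### Continuous functions with compact support -/

section CompactSupport

variable [IsTopologicalAddGroup G] [LocallyCompactSpace G] [T2Space G]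
  {μ : Measure G} [μ.IsAddHaarMeasure] [μ.Regular] {ω : Weight G}

lemma memLp_cc (f : C_c(G, ℂ)) : MemLp f 1 (weightedMeasure μ ω) := by
  rw [memLp_weightedMeasure_iff]
  exact ((Complex.continuous_ofReal.comp ω.continuous').mul
    f.continuous).integrable_of_hasCompactSupport f.hasCompactSupport.mul_left

/-- The class in `L¹_ω(G)` of a continuous function with compact support. -/
noncomputable def ofCc (μ : Measure G) [μ.IsAddHaarMeasure] [μ.Regular] (ω : Weight G)
    (f : C_c(G, ℂ)) : L1 μ ω := (memLp_cc f).toLp f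

lemma ofCc_ae (f : C_c(G, ℂ)) : ofCc μ ω f =ᵐ[μ] f := toLp_ae (memLp_cc f)

/-- `ω⁻¹ φ` as a continuous function with compact support. -/
noncomputable def divWeight (ω : Weight G) (φ : G → ℂ) (hφ : Continuous φ)
    (hφ' : HasCompactSupport φ) : C_c(G, ℂ) where
  toFun t := (ω t : ℂ)⁻¹ * φ t
  continuous_toFun := ((Complex.continuous_ofReal.comp ω.continuous').inv₀
    fun t => Complex.ofReal_ne_zero.2 (ω.pos' t).ne').mul hφ
  hasCompactSupport' := hφ'.mul_left

lemma weight_ne_zero (ω : Weight G) (t : G) : (ω t : ℂ) ≠ 0 :=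
  Complex.ofReal_ne_zero.2 (ω.pos' t).ne'

lemma denseRange_ofCc : DenseRange (ofCc μ ω) := by
  refine Metric.denseRange_iff.2 fun f ε hε => ?_
  obtain ⟨φ, hφ', hle, hφ, -⟩ := exists_cc_approx (integrable_weight_mul f) (half_pos hε)
  refine ⟨divWeight ω φ hφ hφ', ?_⟩
  rw [dist_eq_norm, norm_eq]
  refine lt_of_le_of_lt (le_of_eq ?_) (hle.trans_lt (half_lt_self hε))
  refine integral_congr_ae ?_
  filter_upwards [sub_ae f (ofCc μ ω (divWeight ω φ hφ hφ')),
    ofCc_ae (μ := μ) (ω := ω) (divWeight ω φ hφ hφ')] with t h1 h2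
  rw [h1, h2]
  have e : (ω t : ℂ) * f t - φ t = (ω t : ℂ) * (f t - (ω t : ℂ)⁻¹ * φ t) := by
    rw [mul_sub, mul_inv_cancel_left₀ (weight_ne_zero ω t)]
  rw [e, norm_mul, Complex.norm_real, Real.norm_of_nonneg (ω.pos' t).le]
  rfl

/-- The translates of a continuous function with compact support depend continuously on the
translation, in the norm of `L¹_ω(G)`. -/
lemma continuous_translate_ofCc (f : C_c(G, ℂ)) :
    Continuous fun t => translate μ ω t (ofCc μ ω f) := by
  refine continuous_iff_continuousAt.2 fun t₀ => ?_
  obtain ⟨N, hN, hN₀⟩ := exists_compact_mem_nhds t₀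
  have hnorm : ∀ t, ‖translate μ ω t (ofCc μ ω f) - translate μ ω t₀ (ofCc μ ω f)‖ =
      ∫ s, ω s * ‖f (s - t) - f (s - t₀)‖ ∂μ := fun t => by
    rw [norm_eq]
    refine integral_congr_ae ?_
    filter_upwards [sub_ae (translate μ ω t (ofCc μ ω f)) (translate μ ω t₀ (ofCc μ ω f)),
      translate_ae t (ofCc μ ω f), translate_ae t₀ (ofCc μ ω f),
      comp_sub_right_ae (ofCc_ae (μ := μ) (ω := ω) f) t,
      comp_sub_right_ae (ofCc_ae (μ := μ) (ω := ω) f) t₀] with s h1 h2 h3 h4 h5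
    rw [h1, h2, h3, h4, h5]
  have hcont : ContinuousOn (fun t => ∫ s, ω s * ‖f (s - t) - f (s - t₀)‖ ∂μ) N := by
    refine continuousOn_integral_of_compact_support (hN.add f.hasCompactSupport.isCompact) ?_ ?_
    · have := f.continuous
      have := ω.continuous'
      refine Continuous.continuousOn ?_
      simp only [Function.uncurry_def]
      fun_prop
    · intro t s ht hs
      have h0 : ∀ u ∈ N, f (s - u) = 0 := fun u hu => by
        by_contra hne
        exact hs ⟨u, hu, s - u, subset_tsupport f hne, by simp⟩
      simp [h0 t ht, h0 t₀ (mem_of_mem_nhds hN₀)]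
  rw [ContinuousAt, tendsto_iff_norm_sub_tendsto_zero]
  simp_rw [hnorm]
  simpa using (hcont.continuousAt hN₀).tendsto

/-- The convolution of continuous functions with compact support. -/
noncomputable def ccConv (μ : Measure G) [μ.IsAddHaarMeasure] (f g : C_c(G, ℂ)) : C_c(G, ℂ) where
  toFun s := ∫ t, f t * g (s - t) ∂μ
  continuous_toFun :=
    (conv_cc f.continuous g.continuous f.hasCompactSupport g.hasCompactSupport).1
  hasCompactSupport' :=
    (conv_cc f.continuous g.continuous f.hasCompactSupport g.hasCompactSupport).2.1

lemma conv_ofCc (f g : C_c(G, ℂ)) :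
    conv (ofCc μ ω f) (ofCc μ ω g) = ofCc μ ω (ccConv μ f g) := by
  apply L1_ext
  refine (conv_ae _ _).trans (EventuallyEq.trans (ae_of_all _ fun s => ?_) (ofCc_ae _).symm)
  refine integral_congr_ae ?_
  filter_upwards [ofCc_ae f, comp_sub_left_ae (ofCc_ae g) s] with t h1 h2
  rw [h1, h2]

lemma hasCompactSupport_smul_translate (h : C_c(G, ℂ)) (f : L1 μ ω) :
    HasCompactSupport fun t => h t • translate μ ω t f :=
  h.hasCompactSupport.smul_right

lemma integrable_smul_translate (h f : C_c(G, ℂ)) :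
    Integrable (fun t => h t • translate μ ω t (ofCc μ ω f)) μ :=
  (h.continuous.smul (continuous_translate_ofCc f)).integrable_of_hasCompactSupport
    (hasCompactSupport_smul_translate h _)

lemma L1_integrable (hω : ∀ t, 1 ≤ ω t) (f : L1 μ ω) : Integrable f μ := by
  simpa using integrable_mul_of_le f (ψ := fun _ => 1) measurable_const (C := 1)
    (fun t => by simpa using hω t)

/-- A convolution is a vector-valued integral of translates. The two sides are compared by
integrating over closed sets `S`, where Fubini's theorem applies to `μ` and its restriction to `S`. -/
lemma conv_eq_integral (hω : ∀ t, 1 ≤ ω t) (h f : C_c(G, ℂ)) :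
    conv (ofCc μ ω h) (ofCc μ ω f) = ∫ t, h t • translate μ ω t (ofCc μ ω f) ∂μ := by
  rw [← sub_eq_zero, conv_ofCc]
  rw [Lp.eq_zero_iff_ae_eq_zero, EventuallyEq, ae_weightedMeasure]
  refine ae_eq_zero_of_forall_setIntegral_isClosed_eq_zero (L1_integrable hω _) fun S hS => ?_
  have hS' := hS.measurableSet
  obtain ⟨d, hd⟩ := exists_integral_functional (μ := μ) (ω := ω)
    (ψ := S.indicator fun _ => 1) (measurable_const.indicator hS') (C := 1) (fun t => by
      by_cases ht : t ∈ S
      · simpa [ht] using hω t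
      · simpa [ht] using (ω.pos' t).le)
  have hd' : ∀ u, d u = ∫ s in S, u s ∂μ := fun u => by
    rw [hd, ← integral_indicator hS']
    refine integral_congr_ae (ae_of_all _ fun s => ?_)
    by_cases hs : s ∈ S <;> simp [hs]
  have hdt : ∀ t, d (translate μ ω t (ofCc μ ω f)) = ∫ s in S, f (s - t) ∂μ := fun t => by
    rw [hd']
    exact integral_congr_ae (ae_restrict_of_ae
      ((translate_ae t _).trans (comp_sub_right_ae (ofCc_ae f) t)))
  have hdc : d (ofCc μ ω (ccConv μ h f)) = ∫ s in S, ∫ t, h t * f (s - t) ∂μ ∂μ := by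
    rw [hd']
    exact integral_congr_ae (ae_restrict_of_ae (ofCc_ae _))
  rw [← hd', map_sub, hdc, ← ContinuousLinearMap.integral_comp_comm _
    (integrable_smul_translate h f)]
  simp_rw [map_smul, hdt, smul_eq_mul, ← integral_const_mul]
  rw [sub_eq_zero]
  refine integral_integral_swap_of_hasCompactSupport ?_ ?_
  · have := h.continuous
    have := f.continuous
    simp only [Function.uncurry_def]
    fun_prop
  · have hK : IsCompact ((fun p : G × G => (p.1 + p.2, p.1)) '' (tsupport h ×ˢ tsupport f)) :=
      (h.hasCompactSupport.isCompact.prod f.hasCompactSupport.isCompact).image (by fun_prop)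
    refine HasCompactSupport.intro hK ?_
    rintro ⟨s, t⟩ hst
    by_contra h0
    simp only [Function.uncurry] at h0
    exact hst ⟨(t, s - t), ⟨subset_tsupport h (left_ne_zero_of_mul h0),
      subset_tsupport f (right_ne_zero_of_mul h0)⟩, by simp⟩

lemma map_conv_eq_integral (hω : ∀ t, 1 ≤ ω t) {E : Type*} [NormedAddCommGroup E]
    [NormedSpace ℂ E] [CompleteSpace E] (L : L1 μ ω →L[ℂ] E) (h f : C_c(G, ℂ)) :
    L (conv (ofCc μ ω h) (ofCc μ ω f)) = ∫ t, h t • L (translate μ ω t (ofCc μ ω f)) ∂μ := by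
  rw [conv_eq_integral hω, ← ContinuousLinearMap.integral_comp_comm _
    (integrable_smul_translate h f)]
  simp_rw [map_smul]

/-- Every neighbourhood of `t` supports a nonnegative bump function with value `1` at `t`. -/
lemma exists_bump {U : Set G} {t : G} (hU : U ∈ 𝓝 t) : ∃ e : G → ℝ, Continuous e ∧
    HasCompactSupport e ∧ 0 ≤ e ∧ e t = 1 ∧ ∀ s ∉ U, e s = 0 := by
  obtain ⟨e, h1, h0, he, hI⟩ := exists_continuous_one_zero_of_isCompact
    (isCompact_singleton (x := t)) isOpen_interior.isClosed_compl
    (Set.disjoint_compl_right_iff_subset.2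
      (Set.singleton_subset_iff.2 (mem_interior_iff_mem_nhds.2 hU)))
  exact ⟨e, e.continuous, he, fun s => (hI s).1, h1 rfl,
    fun s hs => h0 fun hs' => hs (interior_subset hs')⟩

/-- Convolution products of continuous functions with compact support are dense: bump functions
at `0` form an approximate identity. -/
lemma dense_conv_ofCc (hω : ∀ t, 1 ≤ ω t) :
    Dense {x : L1 μ ω | ∃ f g, x = conv (ofCc μ ω f) (ofCc μ ω g)} := by
  have key : Set.range (ofCc μ ω) ⊆
      closure {x : L1 μ ω | ∃ f g, x = conv (ofCc μ ω f) (ofCc μ ω g)} := by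
    rintro _ ⟨f, rfl⟩
    refine Metric.mem_closure_iff.2 fun ε hε => ?_
    have hU := (continuous_translate_ofCc (μ := μ) (ω := ω) f).continuousAt (x := 0)
      (Metric.ball_mem_nhds _ (half_pos hε))
    rw [translate_zero] at hU
    obtain ⟨e, hec, hes, he0, he1, heU⟩ := exists_bump hU
    have hei : 0 < ∫ s, e s ∂μ :=
      hec.integral_pos_of_hasCompactSupport_nonneg_nonzero hes he0 (x := 0) (by simp [he1])
    set I := ∫ s, e s ∂μ with hI
    let h : C_c(G, ℂ) :=
      { toFun := fun s => ((e s / I : ℝ) : ℂ)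
        continuous_toFun := Complex.continuous_ofReal.comp (hec.div_const _)
        hasCompactSupport' := hes.comp_left (g := fun r : ℝ => ((r / I : ℝ) : ℂ)) (by simp) }
    have hh : ∀ s, h s = ((e s / I : ℝ) : ℂ) := fun s => rfl
    refine ⟨_, ⟨h, f, rfl⟩, ?_⟩
    have hone : ∫ s, h s ∂μ = 1 := by
      simp_rw [hh]
      rw [integral_complex_ofReal, integral_div, div_self hei.ne', Complex.ofReal_one]
    have hhi : Integrable h μ := h.continuous.integrable_of_hasCompactSupport h.hasCompactSupport
    have e1 : ofCc μ ω f = ∫ s, h s • ofCc μ ω f ∂μ := by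
      rw [integral_smul_const, hone, one_smul]
    rw [dist_comm, dist_eq_norm, conv_eq_integral hω]
    nth_rewrite 2 [e1]
    rw [← integral_sub (integrable_smul_translate h f) (hhi.smul_const _)]
    simp_rw [← smul_sub]
    have hbound : ∀ s, ‖h s • (translate μ ω s (ofCc μ ω f) - ofCc μ ω f)‖ ≤
        e s / I * (ε / 2) := fun s => by
      have hn : ‖h s‖ = e s / I := by
        rw [hh, Complex.norm_real, Real.norm_of_nonneg (div_nonneg (he0 s) hei.le)]
      rw [norm_smul, hn]
      by_cases hs : s ∈ (fun t => translate μ ω t (ofCc μ ω f)) ⁻¹'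
          Metric.ball (ofCc μ ω f) (ε / 2)
      · refine mul_le_mul_of_nonneg_left ?_ (div_nonneg (he0 s) hei.le)
        rw [← dist_eq_norm]
        exact (Metric.mem_ball.1 hs).le
      · simp [heU s hs]
    refine lt_of_le_of_lt (norm_integral_le_of_norm_le
      (((hec.integrable_of_hasCompactSupport hes).div_const I).mul_const _)
      (ae_of_all _ hbound)) ?_
    rw [integral_mul_const, integral_div, div_self hei.ne', one_mul]
    exact half_lt_self hε
  exact fun x => closure_minimal key isClosed_closure (denseRange_ofCc x)

end CompactSupport

/-! ### Point derivations given by additive functions -/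

section PointDerivation

variable [IsTopologicalAddGroup G] [LocallyCompactSpace G] [T2Space G]
  {μ : Measure G} [μ.IsAddHaarMeasure] [μ.Regular] {ω : Weight G}

/-- Dominated convergence in `L¹_ω(G)`. -/
lemma tendsto_of_dominated {x : ℕ → L1 μ ω} {y : L1 μ ω} {H : G → ENNReal} (hH : Measurable H)
    (hHi : ∫⁻ t, H t ∂μ ≠ ⊤) (hb : ∀ n, ∀ᵐ t ∂μ, ‖(ω t : ℂ) * x n t‖ₑ ≤ H t)
    (hl : ∀ᵐ t ∂μ, Tendsto (fun n => (ω t : ℂ) * x n t) atTop (𝓝 ((ω t : ℂ) * y t))) :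
    Tendsto x atTop (𝓝 y) := by
  rw [tendsto_iff_norm_sub_tendsto_zero]
  have hfin := ae_lt_top hH hHi
  have h := tendsto_integral_of_dominated_convergence
    (F := fun n t => ‖(ω t : ℂ) * x n t - (ω t : ℂ) * y t‖) (f := fun _ => (0 : ℝ)) (μ := μ)
    (fun t => (H t).toReal + ‖(ω t : ℂ) * y t‖) ?_ ?_ ?_ ?_
  · rw [integral_zero] at h
    refine h.congr fun n => ?_
    rw [norm_eq]
    refine integral_congr_ae ?_
    filter_upwards [sub_ae (x n) y] with t ht
    rw [ht, ← mul_sub, norm_mul, Complex.norm_real, Real.norm_of_nonneg (ω.pos' t).le]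
  · exact fun n => ((integrable_weight_mul (x n)).sub
      (integrable_weight_mul y)).norm.aestronglyMeasurable
  · exact (integrable_toReal_of_lintegral_ne_top hH.aemeasurable hHi).add
      (integrable_weight_mul y).norm
  · intro n
    filter_upwards [hb n, hfin] with t h1 h2
    rw [norm_norm]
    refine (norm_sub_le _ _).trans (add_le_add ?_ le_rfl)
    rw [← toReal_enorm]
    exact ENNReal.toReal_mono h2.ne h1
  · filter_upwards [hl] with t ht
    exact tendsto_iff_norm_sub_tendsto_zero.1 ht

/-- The functions `ω⁻¹ φ n` converge to `f` in `L¹_ω(G)`, for `φ` and `S` as provided by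
`exists_cc_seq` for `ω f`. -/
lemma tendsto_divWeight {f : L1 μ ω} {φ : ℕ → G → ℂ} {S : ℕ → G → ℝ} {C : ℝ}
    (hφ : ∀ n, Continuous (φ n)) (hφ' : ∀ n, HasCompactSupport (φ n))
    (hS : ∀ n, Continuous (S n)) (hS' : ∀ n, HasCompactSupport (S n)) (hS0 : ∀ n t, 0 ≤ S n t)
    (hSm : ∀ t, Monotone fun n => S n t) (hφS : ∀ n t, ‖φ n t‖ ≤ S n t)
    (hφl : ∀ᵐ t ∂μ, Tendsto (fun n => φ n t) atTop (𝓝 ((ω t : ℂ) * f t)))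
    (hC : ∀ n, ∫ t, S n t ∂μ ≤ C) :
    Tendsto (fun n => ofCc μ ω (divWeight ω (φ n) (hφ n) (hφ' n))) atTop (𝓝 f) := by
  have hm : ∀ n, Measurable fun t => ENNReal.ofReal (S n t) :=
    fun n => (ENNReal.continuous_ofReal.comp (hS n)).measurable
  have hval : ∀ n, ∀ᵐ t ∂μ,
      (ω t : ℂ) * ofCc μ ω (divWeight ω (φ n) (hφ n) (hφ' n)) t = φ n t := fun n => by
    filter_upwards [ofCc_ae (μ := μ) (ω := ω) (divWeight ω (φ n) (hφ n) (hφ' n))] with t ht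
    rw [ht]
    exact mul_inv_cancel_left₀ (weight_ne_zero ω t) _
  refine tendsto_of_dominated (H := fun t => ⨆ n, ENNReal.ofReal (S n t))
    (Measurable.iSup hm) ?_ ?_ ?_
  · rw [lintegral_iSup hm fun n m h t => ENNReal.ofReal_le_ofReal (hSm t h)]
    refine ne_top_of_le_ne_top (ENNReal.ofReal_ne_top (r := C)) (iSup_le fun n => ?_)
    rw [← ofReal_integral_eq_lintegral_ofReal
      ((hS n).integrable_of_hasCompactSupport (hS' n)) (ae_of_all _ (hS0 n))]
    exact ENNReal.ofReal_le_ofReal (hC n)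
  · intro n
    filter_upwards [hval n] with t ht
    rw [ht, ← ofReal_norm]
    exact (ENNReal.ofReal_le_ofReal (hφS n t)).trans
      (le_iSup (fun n => ENNReal.ofReal (S n t)) n)
  · filter_upwards [hφl, ae_all_iff.2 hval] with t h1 h2
    simpa only [h2] using h1

/-- Two elements of `L¹_ω(G)` can be approximated by continuous functions with compact support in
such a way that the convolutions converge as well. This replaces Fubini's theorem, which is not
available on `G × G` when `G` is not second countable. -/
lemma exists_seq_tendsto_conv (f g : L1 μ ω) : ∃ a b : ℕ → C_c(G, ℂ),
    Tendsto (fun n => ofCc μ ω (a n)) atTop (𝓝 f) ∧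
    Tendsto (fun n => ofCc μ ω (b n)) atTop (𝓝 g) ∧
    Tendsto (fun n => conv (ofCc μ ω (a n)) (ofCc μ ω (b n))) atTop (𝓝 (conv f g)) := by
  obtain ⟨φ, S, A, hφ, hφ', hS, hS', hS0, hSm, hφS, hφl, hA⟩ :=
    exists_cc_seq (integrable_weight_mul f)
  obtain ⟨ψ, R, B, hψ, hψ', hR, hR', hR0, hRm, hψR, hψl, hB⟩ :=
    exists_cc_seq (integrable_weight_mul g)
  refine ⟨fun n => divWeight ω (φ n) (hφ n) (hφ' n), fun n => divWeight ω (ψ n) (hψ n) (hψ' n),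
    tendsto_divWeight hφ hφ' hS hS' hS0 hSm hφS hφl hA,
    tendsto_divWeight hψ hψ' hR hR' hR0 hRm hψR hψl hB, ?_⟩
  have h0 := ω.pos'
  have hne := weight_ne_zero ω
  have hωc : Continuous fun t => ((ω t : ℂ))⁻¹ :=
    (Complex.continuous_ofReal.comp ω.continuous').inv₀ hne
  set k : ℕ → G → G → ENNReal := fun n s t => ENNReal.ofReal (S n t * R n (s - t)) with hk
  have hkmeas : ∀ n s, Measurable (k n s) := fun n s =>
    (ENNReal.continuous_ofReal.comp
      ((hS n).mul ((hR n).comp (continuous_sub_left s)))).measurable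
  have hkmono : ∀ s t, Monotone fun n => k n s t := fun s t n m h =>
    ENNReal.ofReal_le_ofReal (mul_le_mul (hSm t h) (hRm _ h) (hR0 _ _) (hS0 _ _))
  have hki : ∀ n s, ∫⁻ t, k n s t ∂μ = ENNReal.ofReal (∫ t, S n t * R n (s - t) ∂μ) := fun n s =>
    (ofReal_integral_eq_lintegral_ofReal
      (((hS n).mul ((hR n).comp (continuous_sub_left s))).integrable_of_hasCompactSupport
        (hS' n).mul_right)
      (ae_of_all _ fun t => mul_nonneg (hS0 _ _) (hR0 _ _))).symm
  -- the dominating function is the convolution of the suprema of `S` and `R`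
  set H : G → ENNReal := fun s => ∫⁻ t, ⨆ n, k n s t ∂μ with hH
  have hHs : ∀ s, H s = ⨆ n, ∫⁻ t, k n s t ∂μ := fun s =>
    lintegral_iSup (fun n => hkmeas n s) fun n m h t => hkmono s t h
  have hmm : ∀ n, Measurable fun s => ∫⁻ t, k n s t ∂μ := fun n => by
    simp_rw [hki]
    exact (ENNReal.continuous_ofReal.comp
      (conv_cc (hS n) (hR n) (hS' n) (hR' n)).1).measurable
  have hHint : ∫⁻ s, H s ∂μ ≤ ENNReal.ofReal (A * B) := by
    simp_rw [hHs]
    rw [lintegral_iSup hmm fun n m h s => lintegral_mono fun t => hkmono s t h]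
    refine iSup_le fun n => ?_
    obtain ⟨h1, h2, h3⟩ := conv_cc (μ := μ) (hS n) (hR n) (hS' n) (hR' n)
    simp_rw [hki]
    rw [← ofReal_integral_eq_lintegral_ofReal (h1.integrable_of_hasCompactSupport h2)
      (ae_of_all _ fun s => integral_nonneg fun t => mul_nonneg (hS0 _ _) (hR0 _ _)), h3]
    exact ENNReal.ofReal_le_ofReal (mul_le_mul (hA n) (hB n)
      (integral_nonneg fun t => hR0 n t) ((integral_nonneg fun t => hS0 n t).trans (hA n)))
  have hHm : Measurable H := by
    rw [show H = fun s => ⨆ n, ∫⁻ t, k n s t ∂μ from funext hHs]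
    exact Measurable.iSup hmm
  have hHfin : ∀ᵐ s ∂μ, H s < ⊤ :=
    ae_lt_top hHm (ne_top_of_le_ne_top ENNReal.ofReal_ne_top hHint)
  have hbd : ∀ n s t, ‖(ω s : ℂ) * (((ω t : ℂ)⁻¹ * φ n t) * ((ω (s - t) : ℂ)⁻¹ * ψ n (s - t)))‖
      ≤ S n t * R n (s - t) := by
    intro n s t
    have e : ‖(ω s : ℂ) * (((ω t : ℂ)⁻¹ * φ n t) * ((ω (s - t) : ℂ)⁻¹ * ψ n (s - t)))‖
        = (ω s / (ω t * ω (s - t))) * (‖φ n t‖ * ‖ψ n (s - t)‖) := by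
      simp only [norm_mul, norm_inv, Complex.norm_real, Real.norm_eq_abs, abs_of_pos (h0 _)]
      field_simp
    rw [e]
    have h1 : ω s / (ω t * ω (s - t)) ≤ 1 := by
      rw [div_le_one (mul_pos (h0 _) (h0 _))]
      exact weight_le_translate ω s t
    calc _ ≤ 1 * (‖φ n t‖ * ‖ψ n (s - t)‖) := by gcongr
      _ ≤ _ := by
        rw [one_mul]
        exact mul_le_mul (hφS _ _) (hψR _ _) (norm_nonneg _) (hS0 _ _)
  have hval : ∀ n, ∀ᵐ s ∂μ, (ω s : ℂ) * conv (ofCc μ ω (divWeight ω (φ n) (hφ n) (hφ' n)))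
      (ofCc μ ω (divWeight ω (ψ n) (hψ n) (hψ' n))) s =
      ∫ t, (ω s : ℂ) * (((ω t : ℂ)⁻¹ * φ n t) * ((ω (s - t) : ℂ)⁻¹ * ψ n (s - t))) ∂μ :=
    fun n => by
    rw [conv_ofCc]
    filter_upwards [ofCc_ae (μ := μ) (ω := ω) (ccConv μ (divWeight ω (φ n) (hφ n) (hφ' n))
      (divWeight ω (ψ n) (hψ n) (hψ' n)))] with s hs
    rw [hs, integral_const_mul]
    rfl
  refine tendsto_of_dominated hHm (ne_top_of_le_ne_top ENNReal.ofReal_ne_top hHint) ?_ ?_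
  · intro n
    filter_upwards [hval n] with s hs
    rw [hs]
    refine (enorm_integral_le_lintegral_enorm _).trans (lintegral_mono fun t => ?_)
    refine le_trans ?_ (le_iSup (fun n => k n s t) n)
    rw [← ofReal_norm]
    exact ENNReal.ofReal_le_ofReal (hbd n s t)
  · filter_upwards [hHfin, ae_all_iff.2 hval, conv_ae f g] with s hs hv hc
    simp only [hv, hc, ← integral_const_mul]
    refine tendsto_integral_of_dominated_convergence (fun t => (⨆ n, k n s t).toReal) ?_ ?_ ?_ ?_
    · exact fun n => (continuous_const.mul ((hωc.mul (hφ n)).mul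
        ((hωc.mul (hψ n)).comp (continuous_sub_left s)))).aestronglyMeasurable
    · exact integrable_toReal_of_lintegral_ne_top
        (Measurable.iSup fun n => hkmeas n s).aemeasurable hs.ne
    · intro n
      filter_upwards [ae_lt_top (Measurable.iSup fun n => hkmeas n s) hs.ne] with t ht
      refine (hbd n s t).trans ?_
      rw [← ENNReal.ofReal_le_iff_le_toReal ht.ne]
      exact le_iSup (fun n => k n s t) n
    · filter_upwards [hφl, (Measure.measurePreserving_sub_left μ s).quasiMeasurePreserving.ae hψl]
        with t h1 h2
      have h3 := ((h1.const_mul ((ω t : ℂ)⁻¹)).mul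
        (h2.const_mul ((ω (s - t) : ℂ)⁻¹))).const_mul (ω s : ℂ)
      simpa [inv_mul_cancel_left₀ (hne _)] using h3

/-- If `0` is the only continuous point derivation at the augmentation character, then `0` is the
only continuous additive function dominated by a multiple of the weight: for such a `ψ`, the
functional `f ↦ ∫ f ψ` is a point derivation. -/
lemma additive_eq_zero (hω : ∀ t, 1 ≤ ω t)
    (hpoint : ∀ d : L1 μ ω →L[ℂ] ℂ, IsAugmentationPointDerivation d → d = 0)
    {ψ : G → ℂ} (hψ : Continuous ψ) (hadd : ∀ s t, ψ (s + t) = ψ s + ψ t) {C : ℝ}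
    (hC : ∀ t, ‖ψ t‖ ≤ C * ω t) (t₀ : G) : ψ t₀ = 0 := by
  obtain ⟨d, hd⟩ := exists_integral_functional (μ := μ) (ω := ω) hψ.measurable hC
  obtain ⟨p, hp⟩ := exists_integral_functional (μ := μ) (ω := ω) (ψ := fun _ => 1)
    measurable_const (C := 1) (fun t => by simpa using hω t)
  have hp' : ∀ f : L1 μ ω, p f = augmentation f := fun f => by simp [hp, augmentation]
  have hdf : ∀ f : C_c(G, ℂ), d (ofCc μ ω f) = ∫ t, f t * ψ t ∂μ := fun f => by
    rw [hd]
    refine integral_congr_ae ?_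
    filter_upwards [ofCc_ae f] with t ht
    rw [ht]
  have hpf : ∀ f : C_c(G, ℂ), p (ofCc μ ω f) = ∫ t, f t ∂μ := fun f => by
    rw [hp', augmentation]
    exact integral_congr_ae (ofCc_ae f)
  have hfi : ∀ f : C_c(G, ℂ), Integrable f μ := fun f =>
    f.continuous.integrable_of_hasCompactSupport f.hasCompactSupport
  have hfψ : ∀ f : C_c(G, ℂ), Integrable (fun t => f t * ψ t) μ := fun f =>
    (f.continuous.mul hψ).integrable_of_hasCompactSupport f.hasCompactSupport.mul_right
  have hdt : ∀ (f : C_c(G, ℂ)) (t : G), d (translate μ ω t (ofCc μ ω f)) =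
      d (ofCc μ ω f) + ψ t * p (ofCc μ ω f) := fun f t => by
    have e : d (translate μ ω t (ofCc μ ω f)) = ∫ s, f (s - t) * ψ (s - t + t) ∂μ := by
      rw [hd]
      refine integral_congr_ae ?_
      filter_upwards [translate_ae t (ofCc μ ω f), comp_sub_right_ae (ofCc_ae f) t] with s h1 h2
      rw [h1, h2, sub_add_cancel]
    rw [e, integral_sub_right_eq_self (fun s => f s * ψ (s + t)) t, hdf, hpf,
      ← integral_const_mul, ← integral_add (hfψ f) ((hfi f).const_mul _)]
    refine integral_congr_ae (ae_of_all _ fun s => ?_)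
    simp only [hadd]
    ring
  have hcc : ∀ f g : C_c(G, ℂ), d (conv (ofCc μ ω f) (ofCc μ ω g)) =
      d (ofCc μ ω f) * p (ofCc μ ω g) + p (ofCc μ ω f) * d (ofCc μ ω g) := fun f g => by
    rw [map_conv_eq_integral hω, hdf f, hpf f, ← integral_mul_const, ← integral_mul_const,
      ← integral_add ((hfψ f).mul_const _) ((hfi f).mul_const _)]
    refine integral_congr_ae (ae_of_all _ fun s => ?_)
    simp only [hdt, smul_eq_mul]
    ring
  have hder : IsAugmentationPointDerivation d := fun f g => by
    obtain ⟨a, b, ha, hb, hab⟩ := exists_seq_tendsto_conv f g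
    have hd' : ∀ {x : ℕ → L1 μ ω} {y}, Tendsto x atTop (𝓝 y) →
      Tendsto (fun n => d (x n)) atTop (𝓝 (d y)) := fun h => (d.continuous.tendsto _).comp h
    have hq : ∀ {x : ℕ → L1 μ ω} {y}, Tendsto x atTop (𝓝 y) →
      Tendsto (fun n => p (x n)) atTop (𝓝 (p y)) := fun h => (p.continuous.tendsto _).comp h
    rw [← hp', ← hp']
    refine tendsto_nhds_unique (hd' hab) ?_
    simp_rw [hcc]
    exact ((hd' ha).mul (hq hb)).add ((hq ha).mul (hd' hb))
  have hd0 := hpoint d hder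
  -- testing `∫ f ψ = 0` with `f` a bump function times the conjugate of `ψ`
  by_contra hne
  obtain ⟨e, hec, hes, he0, he1, -⟩ := exists_bump (univ_mem : Set.univ ∈ 𝓝 t₀)
  let f : C_c(G, ℂ) :=
    { toFun := fun s => (e s : ℂ) * (starRingEnd ℂ) (ψ s)
      continuous_toFun := (Complex.continuous_ofReal.comp hec).mul
        (Complex.continuous_conj.comp hψ)
      hasCompactSupport' := (hes.comp_left (g := fun r : ℝ => (r : ℂ)) (by simp)).mul_right }
  have hf : ∀ s, f s * ψ s = ((e s * ‖ψ s‖ ^ 2 : ℝ) : ℂ) := fun s => by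
    change (e s : ℂ) * (starRingEnd ℂ) (ψ s) * ψ s = _
    rw [mul_assoc, Complex.conj_mul']
    push_cast
    rfl
  have hpos : 0 < ∫ s, e s * ‖ψ s‖ ^ 2 ∂μ :=
    (hec.mul (hψ.norm.pow 2)).integral_pos_of_hasCompactSupport_nonneg_nonzero hes.mul_right
      (fun s => mul_nonneg (he0 s) (by positivity)) (x := t₀) (by simpa [he1] using hne)
  have h := hdf f
  simp_rw [hf] at h
  rw [hd0, integral_complex_ofReal] at h
  exact hpos.ne (Complex.ofReal_injective h)

end PointDerivation

/-! ### Translation defects of derivations -/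

section Derivation

variable [IsTopologicalAddGroup G] [LocallyCompactSpace G] [T2Space G]
  {μ : Measure G} [μ.IsAddHaarMeasure] [μ.Regular] {ω : Weight G}
  {X : Type*} [NormedAddCommGroup X] [NormedSpace ℂ X]

lemma BanachModule.act_comm (N : BanachModule μ ω X) (f g : L1 μ ω) (x : X) :
    N.act f (N.act g x) = N.act g (N.act f x) := by
  rw [← N.act_conv, ← N.act_conv, conv_comm]

/-- The translation defect `(δ₋ₜ * g) · D (δₜ * f) - g · D f` of a linear map `D`. For a derivation
`D` it stands for `(g * f) · (δ₋ₜ · D δₜ)`, but, unlike this expression, it makes sense without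
extending the action or `D` to point masses. -/
noncomputable def defect (N : BanachModule μ ω X) (D : L1 μ ω →L[ℂ] X) (t : G) (f g : L1 μ ω) :
    X :=
  N.act (translate μ ω (-t) g) (D (translate μ ω t f)) - N.act g (D f)

lemma conv_translate_neg_translate (t : G) (f g : L1 μ ω) :
    conv (translate μ ω (-t) f) (translate μ ω t g) = conv f g := by
  rw [conv_translate, translate_conv, translate_translate, add_neg_cancel, translate_zero]

lemma defect_conv_left {N : BanachModule μ ω X} {D : L1 μ ω →L[ℂ] X} (hD : N.IsDerivation D)
    (t : G) (k f g : L1 μ ω) : defect N D t (conv k f) g = N.act k (defect N D t f g) := by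
  rw [defect, defect, ← conv_translate, hD, hD, map_add, map_add, map_sub,
    ← N.act_conv _ (translate μ ω t f), conv_translate_neg_translate, N.act_conv,
    N.act_comm _ k, N.act_comm g k]
  abel

lemma defect_conv_right (N : BanachModule μ ω X) (D : L1 μ ω →L[ℂ] X)
    (t : G) (k f g : L1 μ ω) : defect N D t f (conv k g) = N.act k (defect N D t f g) := by
  rw [defect, defect, ← conv_translate, N.act_conv, N.act_conv, map_sub]

/-- The defect at a product is unchanged when opposite translations are applied to its two
arguments. -/
lemma defect_translate {N : BanachModule μ ω X} {D : L1 μ ω →L[ℂ] X} (hD : N.IsDerivation D)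
    (s t : G) (k f g : L1 μ ω) :
    defect N D s (translate μ ω t (conv k f)) (translate μ ω (-t) g) =
      defect N D s (conv k f) g := by
  rw [← translate_conv, defect_conv_left hD, ← defect_conv_right, conv_comm (translate μ ω t k),
    conv_translate_neg_translate, conv_comm, defect_conv_right, defect_conv_left hD]

lemma defect_add {N : BanachModule μ ω X} {D : L1 μ ω →L[ℂ] X} (hD : N.IsDerivation D)
    (s t : G) (k f g : L1 μ ω) :
    defect N D (s + t) (conv k f) g =
      defect N D s (conv k f) g + defect N D t (conv k f) g := by
  rw [← defect_translate hD s t k f g]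
  simp only [defect, translate_translate, neg_add]
  abel

lemma continuous_defect_left (N : BanachModule μ ω X) (D : L1 μ ω →L[ℂ] X) (t : G) (g : L1 μ ω) :
    Continuous fun f => defect N D t f g := by
  unfold defect
  fun_prop

lemma continuous_defect_right (N : BanachModule μ ω X) (D : L1 μ ω →L[ℂ] X) (t : G)
    (f : L1 μ ω) : Continuous fun g => defect N D t f g := by
  unfold defect
  fun_prop

lemma continuous_defect_ofCc (N : BanachModule μ ω X) (D : L1 μ ω →L[ℂ] X) (f g : C_c(G, ℂ)) :
    Continuous fun t => defect N D t (ofCc μ ω f) (ofCc μ ω g) := by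
  have h1 := continuous_translate_ofCc (μ := μ) (ω := ω) f
  have h2 := (continuous_translate_ofCc (μ := μ) (ω := ω) g).comp continuous_neg
  exact ((N.act.continuous.comp h2).clm_apply (D.continuous.comp h1)).sub continuous_const

/-- A derivation without translation defect is zero: it commutes with translations, hence with
convolutions, so that the product rule leaves no room for it. -/
lemma eq_zero_of_defect_eq_zero [CompleteSpace X] (hω : ∀ t, 1 ≤ ω t) {N : BanachModule μ ω X}
    {D : L1 μ ω →L[ℂ] X} (hD : N.IsDerivation D)
    (h0 : ∀ (t : G) (k f g : C_c(G, ℂ)),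
      defect N D t (conv (ofCc μ ω k) (ofCc μ ω f)) (ofCc μ ω g) = 0) : D = 0 := by
  have h1 : ∀ t f (g : C_c(G, ℂ)), defect N D t f (ofCc μ ω g) = 0 := fun t f g => by
    refine congrFun ((continuous_defect_left N D t _).ext_on (dense_conv_ofCc hω)
      (continuous_const (y := 0)) ?_) f
    rintro _ ⟨k, f, rfl⟩
    exact h0 t k f g
  have h2 : ∀ t f g, defect N D t f g = 0 := fun t f g =>
    congrFun (denseRange_ofCc.equalizer (continuous_defect_right N D t f)
      (continuous_const (y := 0)) (funext fun g => h1 t f g)) g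
  have h3 : ∀ t f g, N.act g (D (translate μ ω t f)) = N.act (translate μ ω t g) (D f) :=
    fun t f g => by
      have h := h2 t f (translate μ ω t g)
      rwa [defect, translate_translate, neg_add_cancel, translate_zero, sub_eq_zero] at h
  have h4 : ∀ h f g : C_c(G, ℂ), N.act (ofCc μ ω g) (D (conv (ofCc μ ω h) (ofCc μ ω f))) =
      N.act (conv (ofCc μ ω h) (ofCc μ ω g)) (D (ofCc μ ω f)) := fun h f g => by
    have e1 := map_conv_eq_integral hω ((N.act (ofCc μ ω g)).comp D) h f
    have e2 := map_conv_eq_integral hω (N.act.flip (D (ofCc μ ω f))) h g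
    simp only [ContinuousLinearMap.comp_apply, ContinuousLinearMap.flip_apply, h3] at e1 e2
    rw [e1, e2]
  have h5 : ∀ h f g : C_c(G, ℂ),
      N.act (conv (ofCc μ ω g) (ofCc μ ω f)) (D (ofCc μ ω h)) = 0 := fun h f g => by
    have h := h4 h f g
    rw [hD, map_add, N.act_conv, N.act_comm (ofCc μ ω g), add_eq_left] at h
    rw [N.act_conv, h]
  have h6 : ∀ f (h : C_c(G, ℂ)), N.act f (D (ofCc μ ω h)) = 0 := fun f h => by
    refine congrFun (((N.act.flip (D (ofCc μ ω h))).continuous).ext_on (dense_conv_ofCc hω)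
      (continuous_const (y := 0)) ?_) f
    rintro _ ⟨g, f, rfl⟩
    exact h5 h f g
  refine ContinuousLinearMap.ext fun f => ?_
  refine congrFun (D.continuous.ext_on (dense_conv_ofCc hω) (continuous_const (y := 0)) ?_) f
  rintro _ ⟨g, f, rfl⟩
  change D _ = 0
  rw [hD, h6, h6, add_zero]

/-- The first term of the defect is controlled by `ω t * σ (-t)`, as `g` enters through the action
of `L¹_σ(G)`; the second one is constant in `t`, and `ω t * σ (-t) ≥ 1`. -/
lemma exists_norm_defect_le {σ : Weight G} (hσω : ∀ t, σ t ≤ ω t)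
    (hωσ : ∀ t, 1 ≤ ω t * σ.tilde t) (M : BanachModule μ σ X) (D : L1 μ ω →L[ℂ] X)
    (f g : L1 μ ω) :
    ∃ C : ℝ, ∀ t, ‖defect (M.restrict hσω) D t f g‖ ≤ C * (ω.mul σ.tilde) t := by
  refine ⟨‖M.act‖ * ‖incl μ hσω g‖ * (‖D‖ * ‖f‖) + ‖M.act (incl μ hσω g) (D f)‖, fun t => ?_⟩
  have h1 : ‖M.act (incl μ hσω (translate μ ω (-t) g)) (D (translate μ ω t f))‖ ≤
      ‖M.act‖ * (σ (-t) * ‖incl μ hσω g‖) * (‖D‖ * (ω t * ‖f‖)) := by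
    rw [incl_translate]
    refine (M.act.le_opNorm₂ _ _).trans ?_
    gcongr
    · exact mul_nonneg (norm_nonneg M.act) (mul_nonneg (σ.pos' _).le (norm_nonneg _))
    · exact norm_translate_le _ _
    · exact (D.le_opNorm _).trans
        (mul_le_mul_of_nonneg_left (norm_translate_le _ _) (norm_nonneg _))
  refine (norm_sub_le _ _).trans ?_
  rw [add_mul]
  refine add_le_add (h1.trans_eq ?_) (le_mul_of_one_le_right (norm_nonneg _) (hωσ t))
  change _ = _ * (ω t * σ (-t))
  ring

end Derivation

end Beurling

theorem theoremT {G : Type*} [AddCommGroup G] [TopologicalSpace G] [IsTopologicalAddGroup G]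
    [LocallyCompactSpace G] [T2Space G] [MeasurableSpace G] [BorelSpace G]
    (μ : MeasureTheory.Measure G) [μ.IsAddHaarMeasure] [μ.Regular]
    (ω σ : Beurling.Weight G)
    (hω : ∀ t, 1 ≤ ω t) (hσω : ∀ t, σ t ≤ ω t) (hωσ : ∀ t, 1 ≤ ω t * σ.tilde t)
    (hpoint : ∀ d : Beurling.L1 μ (ω.mul σ.tilde) →L[ℂ] ℂ,
      Beurling.IsAugmentationPointDerivation d → d = 0)
    {X : Type*} [NormedAddCommGroup X] [NormedSpace ℂ X] [CompleteSpace X]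
    (M : Beurling.BanachModule μ σ X) (D : Beurling.L1 μ ω →L[ℂ] X)
    (hD : (M.restrict hσω).IsDerivation D) : D = 0 := by
  refine Beurling.eq_zero_of_defect_eq_zero hω hD fun t k f g => ?_
  refine SeparatingDual.eq_zero_of_forall_dual_eq_zero (R := ℂ) fun l => ?_
  obtain ⟨C, hC⟩ := Beurling.exists_norm_defect_le hσω hωσ M D
    (Beurling.conv (Beurling.ofCc μ ω k) (Beurling.ofCc μ ω f)) (Beurling.ofCc μ ω g)
  refine Beurling.additive_eq_zero (μ := μ) (ω := ω.mul σ.tilde) hωσ hpoint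
    (ψ := fun t => l (Beurling.defect (M.restrict hσω) D t
      (Beurling.conv (Beurling.ofCc μ ω k) (Beurling.ofCc μ ω f)) (Beurling.ofCc μ ω g)))
    ?_ (fun s t => ?_) (C := ‖l‖ * C) (fun t => ?_) t
  · rw [Beurling.conv_ofCc]
    exact l.continuous.comp (Beurling.continuous_defect_ofCc _ D _ g)
  · rw [Beurling.defect_add hD, map_add]
  · rw [mul_assoc]
    exact (l.le_opNorm _).trans (mul_le_mul_of_nonneg_left (hC t) (norm_nonneg _))
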